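/- Let $1<\rho<2$ and $\kappa^c_\rho=\frac{2\sqrt\rho}{1+\rho}$ (so $\kappa^c_\rho<1$). For $\kappa>0$ and a dimension $d\ge 3$, let $v_d$ be the volume of the Euclidean unit ball of $\mathbb R^d$, and let $\chi_1$ and $\chi_\rho$ be two independent stationary Poisson point processes on $\mathbb R^d$ with respective intensities $$\lambda_1=\frac{\kappa^d}{v_d2^d}\quad\text{and}\quad \lambda_\rho=\frac{\kappa^d}{v_d2^d\rho^d}.$$ Set $$W=d^{-1/2}\big((-1,1)\times(-1,0)\times\mathbb R^{d-2}\big),\qquad W^+=d^{-1/2}\big((0,1)\times(0,1)\times\mathbb R^{d-2}\big),$$ write $B(x,r)$ for the open Euclidean ball with center $x$ and radius $r$, and for $x_0\in W$ let $\mathcal G^+(x_0)$ be the event that there exist $x_1\in\chi_1\cap W^+$ and $x_2\in\chi_\rho\cap W^+$ such that $B(x_0,\rho)\cap B(x_1,1)\neq\varnothing$ and $B(x_1,1)\cap B(x_2,\rho)\neq\varnothing$. Proposition. Let $\kappa\in(\kappa^c_\rho,1)$ and $p\in(0,1)$. There is $d_0$, depending only on $\rho$, $\kappa$ and $p$, such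 that for every $d\ge\max(d_0,3)$ and every $x_0\in W$, the set $\mathcal G^+(x_0)$ is measurable and $$P(\mathcal G^+(x_0))\ge p.$$ -/

import Mathlib

open MeasureTheory ProbabilityTheory

noncomputable section

namespace TwoTypeBoolean

/-- The number of points of the random set `χ` that fall in `A`. -/
def count {Ω E : Type*} (χ : Ω → Set E) (A : Set E) (ω : Ω) : ℕ∞ :=
  (χ ω ∩ A).encard

/-- The σ-algebra on `Ω` generated by the point process `χ`, that is, by its counts on all
measurable sets. -/
abbrev sigmaAlgebra {Ω E : Type*} [MeasurableSpace E] (χ : Ω → Set E) : MeasurableSpace Ω :=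
  ⨆ (A : Set E) (_ : MeasurableSet A), MeasurableSpace.comap (count χ A) inferInstance

/-- `χ` is a Poisson point process on `E` with intensity measure `m`, seen as a random set of points
(this is the usual notion for intensity measures without atoms, such as multiples of the Lebesgue
measure): the number of points in a measurable set `A` of finite intensity is a Poisson
random variable with mean `m A`, and the numbers of points in disjoint sets are independent. -/
structure IsPoissonPointProcess {Ω E : Type*} [MeasurableSpace Ω] [MeasurableSpace E]
    (P : Measure Ω) (m : Measure E) (χ : Ω → Set E) : Prop where
  measurable_count : ∀ A : Set E, MeasurableSet A → Measurable (count χ A)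
  law_count : ∀ A : Set E, MeasurableSet A → m A ≠ ⊤ →
    P.map (count χ A) = (poissonMeasure (m A).toNNReal).map (fun n : ℕ => (n : ℕ∞))
  indep_count : ∀ (n : ℕ) (A : Fin n → Set E), (∀ i, MeasurableSet (A i)) →
    Pairwise (fun i j => Disjoint (A i) (A j)) → iIndepFun (fun i => count χ (A i)) P

/-- A stationary Poisson point process on `ℝ^d` with intensity `lam` (with respect to the
Lebesgue measure). -/
def IsStationaryPoisson {Ω : Type*} [MeasurableSpace Ω] (P : Measure Ω) {d : ℕ} (lam : ℝ)
    (χ : Ω → Set (EuclideanSpace ℝ (Fin d))) : Prop :=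
  IsPoissonPointProcess P (ENNReal.ofReal lam • volume) χ

/-- The volume `v_d` of the unit ball of `ℝ^d`. -/
def unitBallVolume (d : ℕ) : ℝ :=
  (volume (Metric.ball (0 : EuclideanSpace ℝ (Fin d)) 1)).toReal

/-- `κ^c_ρ = 2 √ρ / (1 + ρ)`. -/
def kappaCrit (ρ : ℝ) : ℝ := 2 * √ρ / (1 + ρ)

/-- The intensity `κ^d / (v_d 2^d r^d)` of the centres of the balls of radius `r`. -/
def intensity (κ : ℝ) (d : ℕ) (r : ℝ) : ℝ :=
  κ ^ d / (unitBallVolume d * 2 ^ d * r ^ d)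

/-- `W = d^{-1/2} ((-1,1) × (-1,0) × ℝ^{d-2})`. -/
def slabW (d : ℕ) (hd : 3 ≤ d) : Set (EuclideanSpace ℝ (Fin d)) :=
  {x | x ⟨0, by omega⟩ ∈ Set.Ioo (-(1 / √(d : ℝ))) (1 / √(d : ℝ)) ∧
       x ⟨1, by omega⟩ ∈ Set.Ioo (-(1 / √(d : ℝ))) 0}

/-- `W⁺ = d^{-1/2} ((0,1) × (0,1) × ℝ^{d-2})`. -/
def slabWPlus (d : ℕ) (hd : 3 ≤ d) : Set (EuclideanSpace ℝ (Fin d)) :=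
  {x | x ⟨0, by omega⟩ ∈ Set.Ioo 0 (1 / √(d : ℝ)) ∧
       x ⟨1, by omega⟩ ∈ Set.Ioo 0 (1 / √(d : ℝ))}

/-- The event `𝒢⁺(x₀)`. -/
def eventGPlus {Ω : Type*} {d : ℕ} (hd : 3 ≤ d) (ρ : ℝ)
    (χ₁ χρ : Ω → Set (EuclideanSpace ℝ (Fin d))) (x₀ : EuclideanSpace ℝ (Fin d)) : Set Ω :=
  {ω | ∃ x₁ ∈ χ₁ ω ∩ slabWPlus d hd, ∃ x₂ ∈ χρ ω ∩ slabWPlus d hd,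
    (Metric.ball x₀ ρ ∩ Metric.ball x₁ 1).Nonempty ∧
    (Metric.ball x₁ 1 ∩ Metric.ball x₂ ρ).Nonempty}

end TwoTypeBoolean

end

namespace TwoTypeBoolean

open MeasureTheory ProbabilityTheory Filter Topology
open scoped ENNReal NNReal RealInnerProductSpace

/-! Second moment method. Put `R = 1 + ρ`, `α = κR/2`, and let `s < 1` be close to 1. Count the
pairs `(x, y)` of points of the two processes with `x ∈ innerRegion`, `y ∈ outerRegion` and `dist x
y < R`; any such pair realises the event. Up to factors polynomial in `d`, restricting to the slab
costs nothing, so the mean is at least about `b ^ d` with `b = α² s² / ρ`, and `κ > κ^c_ρ` says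
exactly that `α² / ρ > 1`.

If `M` bounds the mean number of partners of an `x` and `M'` that of a `y`, Cauchy–Schwarz gives a
pair with probability at least `m / (m + M + M' + 1)`, where `m` bounds the mean below. Here `M =
(α/ρ)^d`. For `M'`, in high dimension `y - x` is nearly orthogonal to `x - x₀`, so `y` can be taken
at distance about `√2 R` from `x₀`; then the partners of `y` lie in a ball of radius about `R/√2`,
and `M'` is about `(α/√2)^d`. It is negligible against `b ^ d` because `α > √ρ` and `ρ < 2`.

The moments are computed on a finite partition into small cells, by `le_mul_measure_exists_edge`;
`le_mul_measure_exists_close_pair` transfers the bound to points. The geometry is in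
`volume_ball_le_slab`, `volume_ball_le_outerRegion` and `ball_inter_ball_subset`. -/

/-! ### Moments of Poisson variables and of the counts of a Poisson process. -/

lemma lintegral_poissonMeasure_mul (r : ℝ≥0) (g : ℕ → ℝ≥0∞) :
    ∫⁻ n, (n : ℝ≥0∞) * g n ∂(poissonMeasure r) = r * ∫⁻ n, g (n + 1) ∂(poissonMeasure r) := by
  rw [lintegral_countable', lintegral_countable', ← ENNReal.tsum_mul_left,
    tsum_eq_zero_add' ENNReal.summable]
  simp only [Nat.cast_zero, zero_mul, zero_add]
  refine tsum_congr fun n => ?_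
  have key : ((n + 1 : ℕ) : ℝ≥0∞) * poissonMeasure r {n + 1} = r * poissonMeasure r {n} := by
    rw [poissonMeasure_singleton, poissonMeasure_singleton, ← ENNReal.ofReal_natCast,
      ← ENNReal.ofReal_coe_nnreal, ← ENNReal.ofReal_mul (by positivity),
      ← ENNReal.ofReal_mul (by positivity)]
    congr 1
    rw [Nat.factorial_succ]
    push_cast
    field_simp
    ring
  calc _ = g (n + 1) * (((n + 1 : ℕ) : ℝ≥0∞) * poissonMeasure r {n + 1}) := by ring
    _ = _ := by rw [key]; ring

lemma lintegral_natCast_poissonMeasure (r : ℝ≥0) :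
    ∫⁻ n, (n : ℝ≥0∞) ∂(poissonMeasure r) = r := by
  simpa using lintegral_poissonMeasure_mul r 1

lemma lintegral_natCast_mul_self_poissonMeasure (r : ℝ≥0) :
    ∫⁻ n, (n : ℝ≥0∞) * n ∂(poissonMeasure r) = r * r + r := by
  rw [lintegral_poissonMeasure_mul r (fun n => (n : ℝ≥0∞))]
  simp only [Nat.cast_add, Nat.cast_one]
  rw [lintegral_add_right _ measurable_const, lintegral_natCast_poissonMeasure]
  simp [mul_add]

/-- The counting variable of a random set, with values in `ℝ≥0∞`. -/
noncomputable def ecount {Ω E : Type*} (χ : Ω → Set E) (A : Set E) (ω : Ω) : ℝ≥0∞ := (count χ A ω : ℝ≥0∞)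

lemma measurable_ecount_sigmaAlgebra {Ω E : Type*} [MeasurableSpace E] (χ : Ω → Set E)
    {A : Set E} (hA : MeasurableSet A) : Measurable[sigmaAlgebra χ] (ecount χ A) := by
  have h : Measurable[MeasurableSpace.comap (count χ A) inferInstance] (ecount χ A) :=
    (measurable_from_top (f := fun n : ℕ∞ => (n : ℝ≥0∞))).comp (comap_measurable _)
  exact h.mono (le_iSup₂_of_le A hA le_rfl) le_rfl

section

variable {Ω E : Type*} [MeasurableSpace Ω] [MeasurableSpace E] {P : Measure Ω} {m : Measure E}
  {χ : Ω → Set E}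

lemma IsPoissonPointProcess.sigmaAlgebra_le (h : IsPoissonPointProcess P m χ) :
    sigmaAlgebra χ ≤ (inferInstance : MeasurableSpace Ω) :=
  iSup₂_le fun A hA => (h.measurable_count A hA).comap_le

lemma IsPoissonPointProcess.lintegral_comp_count (h : IsPoissonPointProcess P m χ) {A : Set E}
    (hA : MeasurableSet A) (hm : m A ≠ ⊤) (g : ℕ∞ → ℝ≥0∞) :
    ∫⁻ ω, g (count χ A ω) ∂P = ∫⁻ n, g n ∂(poissonMeasure (m A).toNNReal) := by
  rw [← lintegral_map (measurable_from_top (f := g)) (h.measurable_count A hA),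
    h.law_count A hA hm, lintegral_map measurable_from_top measurable_from_top]

lemma IsPoissonPointProcess.lintegral_ecount (h : IsPoissonPointProcess P m χ) {A : Set E}
    (hA : MeasurableSet A) (hm : m A ≠ ⊤) : ∫⁻ ω, ecount χ A ω ∂P = m A := by
  have := h.lintegral_comp_count hA hm (fun n => (n : ℝ≥0∞))
  simpa [ecount, lintegral_natCast_poissonMeasure, ENNReal.coe_toNNReal hm] using this

lemma IsPoissonPointProcess.lintegral_ecount_mul_self (h : IsPoissonPointProcess P m χ)
    {A : Set E} (hA : MeasurableSet A) (hm : m A ≠ ⊤) :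
    ∫⁻ ω, ecount χ A ω * ecount χ A ω ∂P = m A * m A + m A := by
  have := h.lintegral_comp_count hA hm (fun n => (n : ℝ≥0∞) * n)
  simpa [ecount, lintegral_natCast_mul_self_poissonMeasure, ENNReal.coe_toNNReal hm] using this

lemma IsPoissonPointProcess.lintegral_ecount_mul (h : IsPoissonPointProcess P m χ) {n : ℕ}
    {A : Fin n → Set E} (hA : ∀ i, MeasurableSet (A i))
    (hd : Pairwise (fun i j => Disjoint (A i) (A j))) (hm : ∀ i, m (A i) ≠ ⊤) (i j : Fin n) :
    ∫⁻ ω, ecount χ (A i) ω * ecount χ (A j) ω ∂P =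
      m (A i) * m (A j) + if i = j then m (A i) else 0 := by
  have hmeas : ∀ i, Measurable (ecount χ (A i)) := fun i =>
    (measurable_ecount_sigmaAlgebra χ (hA i)).mono h.sigmaAlgebra_le le_rfl
  rcases eq_or_ne i j with rfl | hij
  · simpa using h.lintegral_ecount_mul_self (hA i) (hm i)
  · have hind : IndepFun (ecount χ (A i)) (ecount χ (A j)) P :=
      ((h.indep_count n A hA hd).indepFun hij).comp
        (measurable_from_top (f := fun n : ℕ∞ => (n : ℝ≥0∞)))
        (measurable_from_top (f := fun n : ℕ∞ => (n : ℝ≥0∞)))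
    have := lintegral_mul_eq_lintegral_mul_lintegral_of_indepFun (hmeas i) (hmeas j) hind
    simp only [Pi.mul_apply] at this
    rw [this, h.lintegral_ecount (hA i) (hm i), h.lintegral_ecount (hA j) (hm j)]
    simp [hij]

end

/-! ### The second moment method on a bipartite graph. -/

/-- Cauchy–Schwarz form of the second moment method. -/
lemma lintegral_mul_self_le_mul_measure {Ω : Type*} [MeasurableSpace Ω] (P : Measure Ω)
    {Z : Ω → ℝ≥0∞} (hZ : Measurable Z) :
    (∫⁻ ω, Z ω ∂P) * (∫⁻ ω, Z ω ∂P) ≤ (∫⁻ ω, Z ω * Z ω ∂P) * P {ω | Z ω ≠ 0} := by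
  have hS : MeasurableSet {ω | Z ω ≠ 0} := (hZ (measurableSet_singleton 0)).compl
  have h := ENNReal.lintegral_mul_le_Lp_mul_Lq P Real.HolderConjugate.two_two hZ.aemeasurable
    ((measurable_const (a := (1 : ℝ≥0∞))).indicator hS).aemeasurable
  have h1 : ∀ ω, (Z * Set.indicator {ω | Z ω ≠ 0} (fun _ => (1 : ℝ≥0∞))) ω = Z ω := by
    intro ω
    by_cases hω : Z ω = 0 <;> simp [hω]
  have h2 : ∀ ω, (Set.indicator {ω | Z ω ≠ 0} (fun _ => (1 : ℝ≥0∞)) ω) ^ (2 : ℝ)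
      = Set.indicator {ω | Z ω ≠ 0} (fun _ => (1 : ℝ≥0∞)) ω := by
    intro ω
    by_cases hω : Z ω = 0 <;> simp [hω]
  simp only [h1, h2, lintegral_indicator_const hS, one_mul] at h
  have h3 : ∀ ω, Z ω ^ (2 : ℝ) = Z ω * Z ω := by
    intro ω
    rw [ENNReal.rpow_two, sq]
  simp only [h3] at h
  have hsq : ∀ a : ℝ≥0∞, a ^ (1 / 2 : ℝ) * a ^ (1 / 2 : ℝ) = a := by
    intro a
    rw [← ENNReal.rpow_add_of_nonneg _ _ (by norm_num) (by norm_num)]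
    norm_num
  calc _ ≤ _ := mul_le_mul' h h
    _ = _ := by rw [mul_mul_mul_comm, hsq, hsq]

/-- Two edges share both endpoints, one endpoint or none; these cases contribute the terms `1`, `M`
and `M'`, and the squared mean. The degree bounds are asked only at vertices of nonzero weight,
since a null cell may contain no point from which to derive them. -/
lemma sum_second_moment_le {ι κ : Type*} [Fintype ι] [Fintype κ] [DecidableEq ι] [DecidableEq κ]
    (p : ι → ℝ≥0∞) (q : κ → ℝ≥0∞) (a : ι → κ → ℝ≥0∞) (ha : ∀ j k, a j k ≤ 1) (M M' : ℝ≥0∞)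
    (hM : ∀ j, p j ≠ 0 → ∑ k, a j k * q k ≤ M) (hM' : ∀ k, q k ≠ 0 → ∑ j, a j k * p j ≤ M') :
    ∑ j, ∑ k, ∑ j', ∑ k', a j k * a j' k' * ((p j * p j' + if j = j' then p j else 0) *
      (q k * q k' + if k = k' then q k else 0)) ≤
    (∑ j, ∑ k, a j k * (p j * q k)) * (∑ j, ∑ k, a j k * (p j * q k) + (M + M' + 1)) := by
  set m := ∑ j, ∑ k, a j k * (p j * q k) with hm
  rw [Finset.sum_mul]
  refine Finset.sum_le_sum fun j _ => ?_
  rw [Finset.sum_mul]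
  refine Finset.sum_le_sum fun k _ => ?_
  have hsplit : ∀ j' k', a j k * a j' k' * ((p j * p j' + if j = j' then p j else 0) *
      (q k * q k' + if k = k' then q k else 0)) =
      a j k * (p j * q k) * (a j' k' * (p j' * q k')) +
      (if j = j' then a j k * (p j * q k) * (a j k' * q k') else 0) +
      (if k = k' then a j k * (p j * q k) * (a j' k * p j') else 0) +
      (if j = j' then if k = k' then a j k * (p j * q k) * a j k else 0 else 0) := by
    intro j' k'
    split_ifs with h1 h2 h2
    · subst h1; subst h2; ring
    · subst h1; ring
    · subst h2; ring
    · ring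
  simp only [hsplit, Finset.sum_add_distrib]
  have e1 : ∑ j', ∑ k', a j k * (p j * q k) * (a j' k' * (p j' * q k')) =
      a j k * (p j * q k) * m := by
    simp only [hm, Finset.mul_sum]
  have e2 : ∑ j', ∑ k', (if j = j' then a j k * (p j * q k) * (a j k' * q k') else 0) =
      a j k * (p j * q k) * ∑ k', a j k' * q k' := by
    rw [Finset.sum_comm]
    simp [Finset.mul_sum]
  have e3 : ∑ j', ∑ k', (if k = k' then a j k * (p j * q k) * (a j' k * p j') else 0) =
      a j k * (p j * q k) * ∑ j', a j' k * p j' := by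
    simp [Finset.mul_sum]
  have e4 : ∑ j', ∑ k', (if j = j' then if k = k' then a j k * (p j * q k) * a j k else 0 else 0)
      = a j k * (p j * q k) * a j k := by
    rw [Finset.sum_comm]
    simp
  rw [e1, e2, e3, e4, mul_add, mul_add, mul_add, add_assoc, add_assoc, add_assoc]
  rcases eq_or_ne (p j) 0 with hp | hp
  · simp [hp]
  rcases eq_or_ne (q k) 0 with hq | hq
  · simp [hq]
  gcongr
  · exact hM j hp
  · exact hM' k hq
  · exact ha j k

/-- Second moment bound for the number of edges joining the points of two independent families. -/
lemma le_mul_measure_exists_edge {Ω ι κ : Type*} {mX mY : MeasurableSpace Ω}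
    [mΩ : MeasurableSpace Ω] (P : Measure Ω) [Fintype ι] [Fintype κ] [DecidableEq ι]
    [DecidableEq κ] (hmX : mX ≤ mΩ) (hmY : mY ≤ mΩ) (hind : Indep mX mY P)
    {X : ι → Ω → ℝ≥0∞} {Y : κ → Ω → ℝ≥0∞} (hX : ∀ j, Measurable[mX] (X j))
    (hY : ∀ k, Measurable[mY] (Y k)) {p : ι → ℝ≥0∞} {q : κ → ℝ≥0∞}
    (hp : ∀ j, p j ≠ ⊤) (hq : ∀ k, q k ≠ ⊤)
    (hX1 : ∀ j, ∫⁻ ω, X j ω ∂P = p j) (hY1 : ∀ k, ∫⁻ ω, Y k ω ∂P = q k)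
    (hX2 : ∀ j j', ∫⁻ ω, X j ω * X j' ω ∂P = p j * p j' + if j = j' then p j else 0)
    (hY2 : ∀ k k', ∫⁻ ω, Y k ω * Y k' ω ∂P = q k * q k' + if k = k' then q k else 0)
    (a : ι → κ → ℝ≥0∞) (ha : ∀ j k, a j k ≤ 1) (M M' : ℝ≥0∞)
    (hM : ∀ j, p j ≠ 0 → ∑ k, a j k * q k ≤ M) (hM' : ∀ k, q k ≠ 0 → ∑ j, a j k * p j ≤ M') :
    ∑ j, ∑ k, a j k * (p j * q k) ≤ (∑ j, ∑ k, a j k * (p j * q k) + (M + M' + 1)) *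
      P {ω | ∃ j k, a j k ≠ 0 ∧ X j ω ≠ 0 ∧ Y k ω ≠ 0} := by
  have hXm : ∀ j, Measurable (X j) := fun j => (hX j).mono hmX le_rfl
  have hYm : ∀ k, Measurable (Y k) := fun k => (hY k).mono hmY le_rfl
  set Z : Ω → ℝ≥0∞ := fun ω => ∑ j, ∑ k, a j k * (X j ω * Y k ω) with hZ
  have hZm : Measurable Z := by fun_prop
  set m := ∑ j, ∑ k, a j k * (p j * q k) with hm
  have hmtop : m ≠ ⊤ := by
    simp only [hm, ne_eq, ENNReal.sum_eq_top, not_exists, not_and]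
    intro j _ k _
    exact ENNReal.mul_ne_top (ne_top_of_le_ne_top ENNReal.one_ne_top (ha j k))
      (ENNReal.mul_ne_top (hp j) (hq k))
  have hEZ : ∫⁻ ω, Z ω ∂P = m := by
    simp only [hZ, hm]
    rw [lintegral_finsetSum _ (fun j _ => by fun_prop)]
    refine Finset.sum_congr rfl fun j _ => ?_
    rw [lintegral_finsetSum _ (fun j _ => by fun_prop)]
    refine Finset.sum_congr rfl fun k _ => ?_
    rw [lintegral_const_mul _ (by fun_prop)]
    have := lintegral_mul_eq_lintegral_mul_lintegral_of_independent_measurableSpace hmX hmY hind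
      (hX j) (hY k)
    rw [this, hX1, hY1]
  have hEZ2 : ∫⁻ ω, Z ω * Z ω ∂P = ∑ j, ∑ k, ∑ j', ∑ k', a j k * a j' k' *
      ((p j * p j' + if j = j' then p j else 0) *
      (q k * q k' + if k = k' then q k else 0)) := by
    have hexp : ∀ ω, Z ω * Z ω = ∑ j, ∑ k, ∑ j', ∑ k', a j k * a j' k' *
        ((X j ω * X j' ω) * (Y k ω * Y k' ω)) := by
      intro ω
      simp only [hZ]
      rw [Finset.sum_mul]
      refine Finset.sum_congr rfl fun j _ => ?_
      rw [Finset.sum_mul]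
      refine Finset.sum_congr rfl fun k _ => ?_
      simp only [Finset.mul_sum]
      refine Finset.sum_congr rfl fun j' _ => Finset.sum_congr rfl fun k' _ => ?_
      ring
    simp only [hexp]
    rw [lintegral_finsetSum _ (fun _ _ => by fun_prop)]
    refine Finset.sum_congr rfl fun j _ => ?_
    rw [lintegral_finsetSum _ (fun _ _ => by fun_prop)]
    refine Finset.sum_congr rfl fun k _ => ?_
    rw [lintegral_finsetSum _ (fun _ _ => by fun_prop)]
    refine Finset.sum_congr rfl fun j' _ => ?_
    rw [lintegral_finsetSum _ (fun _ _ => by fun_prop)]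
    refine Finset.sum_congr rfl fun k' _ => ?_
    rw [lintegral_const_mul _ (by fun_prop)]
    have := lintegral_mul_eq_lintegral_mul_lintegral_of_independent_measurableSpace hmX hmY hind
      ((hX j).mul (hX j')) ((hY k).mul (hY k'))
    simp only [Pi.mul_apply] at this
    rw [this, hX2, hY2]
  have hset : {ω | Z ω ≠ 0} ⊆ {ω | ∃ j k, a j k ≠ 0 ∧ X j ω ≠ 0 ∧ Y k ω ≠ 0} := by
    intro ω hω
    simp only [hZ, Set.mem_ofPred_eq, ne_eq, Finset.sum_eq_zero_iff, Finset.mem_univ,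
      forall_const, mul_eq_zero, not_forall, not_or] at hω ⊢
    exact hω
  have hCS := lintegral_mul_self_le_mul_measure P hZm
  rw [hEZ, hEZ2] at hCS
  have h1 : m * m ≤ m * ((m + (M + M' + 1)) *
      P {ω | ∃ j k, a j k ≠ 0 ∧ X j ω ≠ 0 ∧ Y k ω ≠ 0}) := by
    refine hCS.trans ?_
    rw [← mul_assoc]
    exact mul_le_mul' (sum_second_moment_le p q a ha M M' hM hM') (measure_mono hset)
  rcases eq_or_ne m 0 with h0 | h0
  · rw [h0]; exact zero_le
  · exact (ENNReal.mul_le_mul_iff_right h0 hmtop).mp h1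

/-! ### Volume estimates: half balls, intersections of balls, slabs. -/

section

variable {E : Type*} [NormedAddCommGroup E] [InnerProductSpace ℝ E]

/-- The point reflection `y ↦ 2c - y` preserves `μ` and the ball, and exchanges the two half balls.
-/
lemma measure_ball_le_two_mul_halfBall [FiniteDimensional ℝ E] [MeasurableSpace E] [BorelSpace E]
    (μ : Measure E) [μ.IsAddHaarMeasure] (c w : E) (r : ℝ) :
    μ (Metric.ball c r) ≤ 2 * μ {y | y ∈ Metric.ball c r ∧ 0 ≤ ⟪y - c, w⟫} := by
  set H : Set E := {y | y ∈ Metric.ball c r ∧ 0 ≤ ⟪y - c, w⟫} with hH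
  have hHm : MeasurableSet H :=
    measurableSet_ball.inter
      (measurableSet_le measurable_const (by fun_prop : Continuous fun y => ⟪y - c, w⟫).measurable)
  have hmp := Measure.measurePreserving_sub_left μ (c + c)
  have h1 : μ ((fun y => c + c - y) ⁻¹' H) = μ H := hmp.measure_preimage hHm.nullMeasurableSet
  have h2 : Metric.ball c r ⊆ H ∪ (fun y => c + c - y) ⁻¹' H := by
    intro y hy
    rcases le_total 0 ⟪y - c, w⟫ with h | h
    · exact Or.inl ⟨hy, h⟩
    · refine Or.inr ⟨?_, ?_⟩
      · rw [Metric.mem_ball, dist_eq_norm] at hy ⊢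
        rwa [show c + c - y - c = -(y - c) by abel, norm_neg]
      · rw [show c + c - y - c = -(y - c) by abel, inner_neg_left]
        linarith
  calc μ (Metric.ball c r) ≤ μ (H ∪ (fun y => c + c - y) ⁻¹' H) := measure_mono h2
    _ ≤ μ H + μ ((fun y => c + c - y) ⁻¹' H) := measure_union_le _ _
    _ = 2 * μ H := by rw [h1, two_mul]

/-- By the parallelogram law, the squared distance of `z` to the midpoint is the average of its
squared distances to `x` and `y`, minus `‖x - y‖² / 4`. -/
lemma ball_inter_ball_subset (x y : E) {R t : ℝ} (ht : 0 < t)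
    (h : R ^ 2 - ‖x - y‖ ^ 2 / 4 ≤ t ^ 2) :
    Metric.ball x R ∩ Metric.ball y R ⊆ Metric.ball ((1 / 2 : ℝ) • (x + y)) t := by
  rintro z ⟨hx, hy⟩
  rw [Metric.mem_ball, dist_eq_norm] at hx hy ⊢
  have hp := parallelogram_law_with_norm ℝ (z - x) (z - y)
  rw [show z - x - (z - y) = -(x - y) by abel, norm_neg,
    show z - x + (z - y) = (2 : ℝ) • (z - (1 / 2 : ℝ) • (x + y)) by module, norm_smul,
    Real.norm_ofNat] at hp
  refine lt_of_pow_lt_pow_left₀ 2 ht.le ?_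
  have h1 : ‖z - x‖ ^ 2 < R ^ 2 := by gcongr
  have h2 : ‖z - y‖ ^ 2 < R ^ 2 := by gcongr
  nlinarith

end

lemma exists_halfGrid {h u : ℝ} (hh : 0 < h) {K : ℕ} (hu : 2 * |u| ≤ (K - 1) * h) :
    ∃ i ∈ Finset.Icc (-(K : ℤ)) K, u - i * (h / 2) ∈ Set.Ioo 0 h := by
  have hK : 2 * |u| / h ≤ K - 1 := by rwa [div_le_iff₀ hh]
  have h1 := Int.ceil_lt_add_one (2 * u / h)
  have h2 := Int.le_ceil (2 * u / h)
  have habs : |2 * u / h| ≤ K - 1 := by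
    rwa [abs_div, abs_mul, abs_two, abs_of_pos hh]
  obtain ⟨h3, h4⟩ := abs_le.mp habs
  -- This choice puts the remainder in `(0, h/2]`. The half step keeps it inside the open interval
  -- for every `u`, with no exceptional boundary points.
  refine ⟨⌈2 * u / h⌉ - 1, ?_, ?_⟩
  · rw [Finset.mem_Icc]
    constructor
    · have : (-(K : ℝ)) ≤ ((⌈2 * u / h⌉ - 1 : ℤ) : ℝ) := by push_cast; linarith
      exact_mod_cast this
    · have : ((⌈2 * u / h⌉ - 1 : ℤ) : ℝ) ≤ (K : ℝ) := by push_cast; linarith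
      exact_mod_cast this
  · have e : u = (2 * u / h) * (h / 2) := by field_simp
    set v := 2 * u / h
    push_cast
    constructor <;> rw [e] <;> nlinarith

lemma inv_sqrt_sq (d : ℕ) : (1 / √(d : ℝ)) ^ 2 = 1 / d := by
  rw [div_pow, Real.sq_sqrt (Nat.cast_nonneg d), one_pow]

variable {d : ℕ}

/-- Translations along the first two coordinates, by a grid of step `h/2`, bring every point of the
half ball into the slab. They do not change the inner product with `w`, and polynomially many
suffice. -/
lemma volume_halfBall_le_slab (hd : 3 ≤ d) (c w : EuclideanSpace ℝ (Fin d))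
    (hc0 : |c ⟨0, by omega⟩| ≤ 1 / √(d : ℝ)) (hc1 : |c ⟨1, by omega⟩| ≤ 1 / √(d : ℝ))
    (hw0 : w ⟨0, by omega⟩ = 0) (hw1 : w ⟨1, by omega⟩ = 0) {r : ℝ} (hr : r ≤ 3) :
    volume {y | y ∈ Metric.ball c r ∧ 0 ≤ ⟪y - c, w⟫} ≤
      ((20 * d + 1) ^ 2 : ℕ) *
        volume {z | z ∈ slabWPlus d hd ∧ 0 ≤ ⟪z - c, w⟫ ∧ ‖z - c‖ ^ 2 < r ^ 2 + 8 / d} := by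
  set i0 : Fin d := ⟨0, by omega⟩ with hi0
  set i1 : Fin d := ⟨1, by omega⟩ with hi1
  have h01 : i0 ≠ i1 := by simp [hi0, hi1]
  set h : ℝ := 1 / √(d : ℝ) with hh
  have hdpos : (3 : ℝ) ≤ d := by exact_mod_cast hd
  have hhpos : 0 < h := by positivity
  have hh2 : h ^ 2 = 1 / d := inv_sqrt_sq d
  have hh1 : h ≤ 1 := by
    have : h ^ 2 ≤ 1 := by rw [hh2, div_le_one] <;> linarith
    nlinarith
  have hdh : 1 ≤ d * h := by
    have : h * (d * h) = 1 := by rw [show h * (d * h) = d * h ^ 2 by ring, hh2]; field_simp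
    nlinarith
  set T : Set (EuclideanSpace ℝ (Fin d)) :=
    {z | z ∈ slabWPlus d hd ∧ 0 ≤ ⟪z - c, w⟫ ∧ ‖z - c‖ ^ 2 < r ^ 2 + 8 / d} with hT
  let t : ℤ × ℤ → EuclideanSpace ℝ (Fin d) := fun ij =>
    (ij.1 * (h / 2)) • EuclideanSpace.single i0 (1 : ℝ) +
      (ij.2 * (h / 2)) • EuclideanSpace.single i1 (1 : ℝ)
  let I : Finset (ℤ × ℤ) := Finset.Icc (-((10 * d : ℕ) : ℤ)) ((10 * d : ℕ) : ℤ) ×ˢ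
    Finset.Icc (-((10 * d : ℕ) : ℤ)) ((10 * d : ℕ) : ℤ)
  have hcover : {y | y ∈ Metric.ball c r ∧ 0 ≤ ⟪y - c, w⟫} ⊆
      ⋃ ij ∈ I, (fun y => y - t ij) ⁻¹' T := by
    rintro y ⟨hy, hyw⟩
    rw [Metric.mem_ball, dist_eq_norm] at hy
    -- Here `|y i| ≤ 3 + h`, and `6 + 3h ≤ 9 ≤ 10dh`.
    have hcoord : ∀ i, |c i| ≤ h → 2 * |y i| ≤ (((10 * d : ℕ) : ℝ) - 1) * h := by
      intro i hci
      have h1 : |(y - c) i| ≤ ‖y - c‖ := by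
        simpa using PiLp.norm_apply_le (y - c) i
      have h2 : |y i| ≤ |(y - c) i| + |c i| := by
        simpa using abs_add_le (y i - c i) (c i)
      push_cast
      nlinarith
    obtain ⟨i, hi, hi'⟩ := exists_halfGrid hhpos (hcoord i0 hc0)
    obtain ⟨j, hj, hj'⟩ := exists_halfGrid hhpos (hcoord i1 hc1)
    simp only [Set.mem_iUnion]
    refine ⟨(i, j), Finset.mem_product.mpr ⟨hi, hj⟩, ?_⟩
    have ht0 : (t (i, j)) i0 = i * (h / 2) := by simp [t, h01]
    have ht1 : (t (i, j)) i1 = j * (h / 2) := by simp [t, h01.symm]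
    have hyc : y - t (i, j) - c = (y - c) - t (i, j) := by abel
    refine ⟨⟨?_, ?_⟩, ?_, ?_⟩
    · change (y - t (i, j)) i0 ∈ _
      rw [PiLp.sub_apply, ht0]; exact hi'
    · change (y - t (i, j)) i1 ∈ _
      rw [PiLp.sub_apply, ht1]; exact hj'
    · have : ⟪t (i, j), w⟫ = 0 := by
        simp [t, inner_add_left, inner_smul_left, EuclideanSpace.inner_single_left, hw0, hw1]
      rw [hyc, inner_sub_left, this, sub_zero]
      exact hyw
    · have e1 : ⟪y - c, t (i, j)⟫ = i * (h / 2) * (y i0 - c i0) + j * (h / 2) * (y i1 - c i1) := by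
        simp [t, inner_add_right, inner_smul_right, EuclideanSpace.inner_single_right]
      have e2 : ‖t (i, j)‖ ^ 2 = (i * (h / 2)) ^ 2 + (j * (h / 2)) ^ 2 := by
        rw [← real_inner_self_eq_norm_sq]
        have : ⟪t (i, j), t (i, j)⟫ = i * (h / 2) * (t (i, j)) i0 + j * (h / 2) * (t (i, j)) i1 := by
          conv_lhs => arg 3; simp only [t]
          simp [inner_add_right, inner_smul_right, EuclideanSpace.inner_single_right]
        rw [this, ht0, ht1]; ring
      rw [hyc, norm_sub_sq_real, e1, e2]
      have h3 : ‖y - c‖ ^ 2 < r ^ 2 := by gcongr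
      obtain ⟨a1, a2⟩ := hi'
      obtain ⟨b1, b2⟩ := hj'
      obtain ⟨c1, c2⟩ := abs_le.mp hc0
      obtain ⟨d1, d2⟩ := abs_le.mp hc1
      -- After translation each of the two coordinates is within `2h` of that of `c`, so the squared
      -- norm grows by at most `8h² = 8/d`.
      have h4 : (y i0 - i * (h / 2) - c i0) ^ 2 ≤ (2 * h) ^ 2 := sq_le_sq' (by linarith) (by linarith)
      have h5 : (y i1 - j * (h / 2) - c i1) ^ 2 ≤ (2 * h) ^ 2 := sq_le_sq' (by linarith) (by linarith)
      have h6 : (8 : ℝ) / d = 8 * h ^ 2 := by rw [hh2]; ring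
      rw [h6]
      nlinarith [sq_nonneg (y i0 - c i0), sq_nonneg (y i1 - c i1)]
  have hcard : I.card = (20 * d + 1) ^ 2 := by
    simp only [I, Finset.card_product, Int.card_Icc]
    rw [sq]
    congr 1 <;> omega
  calc _ ≤ volume (⋃ ij ∈ I, (fun y => y - t ij) ⁻¹' T) := measure_mono hcover
    _ ≤ ∑ ij ∈ I, volume ((fun y => y - t ij) ⁻¹' T) := measure_biUnion_finset_le _ _
    _ = ∑ ij ∈ I, volume T := by
      refine Finset.sum_congr rfl fun ij _ => ?_
      simp only [sub_eq_add_neg]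
      exact measure_preimage_add_right _ _ _
    _ = _ := by rw [Finset.sum_const, hcard, nsmul_eq_mul]

lemma volume_ball_eq (x : EuclideanSpace ℝ (Fin d)) {r : ℝ} (hr : 0 < r) :
    volume (Metric.ball x r) =
      ENNReal.ofReal (r ^ d) * volume (Metric.ball (0 : EuclideanSpace ℝ (Fin d)) 1) := by
  rw [Measure.addHaar_ball_of_pos _ _ hr, finrank_euclideanSpace_fin]

/-- The concentric ball of radius `s * r` has relative volume `s ^ d`, which beats the polynomial
loss, so it can be removed. -/
lemma volume_ball_le_slab (hd : 3 ≤ d) (c w : EuclideanSpace ℝ (Fin d))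
    (hc0 : |c ⟨0, by omega⟩| ≤ 1 / √(d : ℝ)) (hc1 : |c ⟨1, by omega⟩| ≤ 1 / √(d : ℝ))
    (hw0 : w ⟨0, by omega⟩ = 0) (hw1 : w ⟨1, by omega⟩ = 0) {r s : ℝ} (hr0 : 0 < r) (hr : r ≤ 3)
    (hs : 0 < s) (hsd : 4 * (20 * d + 1) ^ 2 * s ^ d ≤ 1) :
    volume (Metric.ball c r) ≤ ((4 * (20 * d + 1) ^ 2 : ℕ) : ℝ≥0∞) *
        volume {z | z ∈ slabWPlus d hd ∧ 0 ≤ ⟪z - c, w⟫ ∧ ‖z - c‖ ^ 2 < r ^ 2 + 8 / d ∧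
          s * r ≤ ‖z - c‖} := by
  set S := {z | z ∈ slabWPlus d hd ∧ 0 ≤ ⟪z - c, w⟫ ∧ ‖z - c‖ ^ 2 < r ^ 2 + 8 / d ∧
          s * r ≤ ‖z - c‖} with hS
  have h1 := measure_ball_le_two_mul_halfBall volume c w r
  have h2 := volume_halfBall_le_slab hd c w hc0 hc1 hw0 hw1 hr
  have h3 : volume {z | z ∈ slabWPlus d hd ∧ 0 ≤ ⟪z - c, w⟫ ∧ ‖z - c‖ ^ 2 < r ^ 2 + 8 / d} ≤
      volume S + volume (Metric.ball c (s * r)) := by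
    refine (measure_mono ?_).trans (measure_union_le _ _)
    rintro z ⟨hz1, hz2, hz3⟩
    rcases le_or_gt (s * r) ‖z - c‖ with h | h
    · exact Or.inl ⟨hz1, hz2, hz3, h⟩
    · refine Or.inr ?_
      rwa [Metric.mem_ball, dist_eq_norm]
  set N : ℕ := (20 * d + 1) ^ 2 with hN
  have hball : 4 * (N : ℝ≥0∞) * volume (Metric.ball c (s * r)) ≤ volume (Metric.ball c r) := by
    rw [volume_ball_eq c hr0, volume_ball_eq c (mul_pos hs hr0), ← mul_assoc]
    gcongr
    rw [← ENNReal.ofReal_natCast, ← ENNReal.ofReal_ofNat, ← ENNReal.ofReal_mul (by norm_num),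
      ← ENNReal.ofReal_mul (by positivity)]
    apply ENNReal.ofReal_le_ofReal
    have hNr : (N : ℝ) = (20 * d + 1) ^ 2 := by rw [hN]; push_cast; ring
    rw [hNr, mul_pow, ← mul_assoc]
    exact mul_le_of_le_one_left (by positivity) hsd
  have hfin : volume (Metric.ball c r) ≠ ⊤ := measure_ball_lt_top.ne
  have h4 : 2 * volume (Metric.ball c r) ≤
      ((4 * N : ℕ) : ℝ≥0∞) * volume S + volume (Metric.ball c r) := by
    calc 2 * volume (Metric.ball c r)
        ≤ 2 * (2 * (N * (volume S + volume (Metric.ball c (s * r))))) := by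
          gcongr
          exact h1.trans (by gcongr; exact h2.trans (by gcongr))
      _ = ((4 * N : ℕ) : ℝ≥0∞) * volume S + 4 * (N : ℝ≥0∞) * volume (Metric.ball c (s * r)) := by
          push_cast; ring
      _ ≤ _ := by gcongr
  rw [two_mul] at h4
  exact (ENNReal.add_le_add_iff_right hfin).mp h4

/-! ### Discretization into cells, and measurability of pair events. -/

/-- A compact set is covered by finitely many disjoint measurable cells of small diameter. -/
lemma exists_finite_cells {X : Type*} [PseudoMetricSpace X] [MeasurableSpace X]
    [OpensMeasurableSpace X] {K : Set X} (hK : IsCompact K) {δ : ℝ} (hδ : 0 < δ) :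
    ∃ (n : ℕ) (C : Fin n → Set X), (∀ i, MeasurableSet (C i)) ∧
      Pairwise (fun i j => Disjoint (C i) (C j)) ∧
      (∀ i, ∀ x ∈ C i, ∀ y ∈ C i, dist x y < δ) ∧ K ⊆ ⋃ i, C i := by
  obtain ⟨t, -, htf, ht⟩ := hK.finite_cover_balls (half_pos hδ)
  obtain ⟨n, f, -, rfl⟩ := htf.fin_param
  refine ⟨n, fun i => Metric.ball (f i) (δ / 2) \ ⋃ j : Set.Iio i, Metric.ball (f j) (δ / 2),
    fun i => measurableSet_ball.diff (MeasurableSet.iUnion fun j => measurableSet_ball),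
    ?_, ?_, ?_⟩
  · have hlt : ∀ i j : Fin n, i < j →
        Disjoint (Metric.ball (f i) (δ / 2) \ ⋃ k : Set.Iio i, Metric.ball (f k) (δ / 2))
          (Metric.ball (f j) (δ / 2) \ ⋃ k : Set.Iio j, Metric.ball (f k) (δ / 2)) := by
      intro i j hij
      rw [Set.disjoint_left]
      rintro x ⟨hx, -⟩ ⟨-, hx'⟩
      exact hx' (Set.mem_iUnion.mpr ⟨⟨i, hij⟩, hx⟩)
    intro i j hij
    rcases lt_or_gt_of_ne hij with h | h
    · exact hlt i j h
    · exact (hlt j i h).symm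
  · rintro i x ⟨hx, -⟩ y ⟨hy, -⟩
    rw [Metric.mem_ball] at hx hy
    linarith [dist_triangle_right x y (f i)]
  · intro x hx
    have hex : ∃ i, x ∈ Metric.ball (f i) (δ / 2) := by simpa using ht hx
    obtain ⟨i, hi, hmin⟩ := exists_minimal_of_wellFoundedLT _ hex
    refine Set.mem_iUnion.mpr ⟨i, hi, ?_⟩
    rw [Set.mem_iUnion]
    rintro ⟨⟨j, hj⟩, hxj⟩
    exact absurd (hmin hxj hj.le) (not_le.mpr hj)

lemma count_ne_zero_iff {Ω E : Type*} (χ : Ω → Set E) (A : Set E) (ω : Ω) :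
    count χ A ω ≠ 0 ↔ ∃ x ∈ χ ω, x ∈ A := by
  simp [count, Set.eq_empty_iff_forall_notMem]

lemma ecount_ne_zero_iff {Ω E : Type*} (χ : Ω → Set E) (A : Set E) (ω : Ω) :
    ecount χ A ω ≠ 0 ↔ ∃ x ∈ χ ω, x ∈ A := by
  rw [← count_ne_zero_iff, ecount, ne_eq, ENat.toENNReal_eq_zero]

/-- The event that a pair of points of two point processes lies in a given open set is
measurable. -/
lemma measurableSet_exists_pair_mem {Ω E : Type*} [MeasurableSpace Ω] [TopologicalSpace E]
    [SecondCountableTopology E] [MeasurableSpace E] [BorelSpace E] {χ χ' : Ω → Set E}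
    (h : ∀ A, MeasurableSet A → Measurable (count χ A))
    (h' : ∀ A, MeasurableSet A → Measurable (count χ' A)) {U : Set (E × E)} (hU : IsOpen U) :
    MeasurableSet {ω | ∃ x ∈ χ ω, ∃ y ∈ χ' ω, (x, y) ∈ U} := by
  let b := TopologicalSpace.countableBasis E
  have hb := TopologicalSpace.isBasis_countableBasis E
  have heq : {ω | ∃ x ∈ χ ω, ∃ y ∈ χ' ω, (x, y) ∈ U} =
      ⋃ uv ∈ {uv : Set E × Set E | uv ∈ b ×ˢ b ∧ uv.1 ×ˢ uv.2 ⊆ U},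
        {ω | count χ uv.1 ω ≠ 0} ∩ {ω | count χ' uv.2 ω ≠ 0} := by
    ext ω
    simp only [Set.mem_iUnion]
    constructor
    · rintro ⟨x, hx, y, hy, hxy⟩
      obtain ⟨u, v, hu, hv, hxu, hyv, huv⟩ := isOpen_prod_iff.mp hU x y hxy
      obtain ⟨u', hu'b, hxu', hu'⟩ := hb.exists_subset_of_mem_open hxu hu
      obtain ⟨v', hv'b, hyv', hv'⟩ := hb.exists_subset_of_mem_open hyv hv
      exact ⟨(u', v'), ⟨⟨hu'b, hv'b⟩, (Set.prod_mono hu' hv').trans huv⟩,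
        (count_ne_zero_iff _ _ _).mpr ⟨x, hx, hxu'⟩, (count_ne_zero_iff _ _ _).mpr ⟨y, hy, hyv'⟩⟩
    · rintro ⟨⟨u, v⟩, ⟨-, huv⟩, h1, h2⟩
      obtain ⟨x, hx, hxu⟩ := (count_ne_zero_iff _ _ _).mp h1
      obtain ⟨y, hy, hyv⟩ := (count_ne_zero_iff _ _ _).mp h2
      exact ⟨x, hx, y, hy, huv ⟨hxu, hyv⟩⟩
  rw [heq]
  have hcb : b.Countable := TopologicalSpace.countable_countableBasis E
  refine MeasurableSet.biUnion ((hcb.prod hcb).mono fun uv huv => huv.1) ?_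
  rintro ⟨u, v⟩ ⟨⟨hu, hv⟩, -⟩
  exact (h u (hb.isOpen hu).measurableSet (measurableSet_singleton 0)).compl.inter
    (h' v (hb.isOpen hv).measurableSet (measurableSet_singleton 0)).compl

/-- Monotonicity of `m ↦ m / (m + K)`: the mean may be replaced by a lower bound. -/
lemma le_add_mul_of_le {m m₀ K t : ℝ≥0∞} (hm : m ≠ ⊤) (hK : K ≠ ⊤) (hK0 : K ≠ 0) (h₀ : m₀ ≤ m)
    (h : m ≤ (m + K) * t) : m₀ ≤ (m₀ + K) * t := by
  have hne : m + K ≠ 0 := by simp [hK0]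
  refine (ENNReal.mul_le_mul_iff_right hne (ENNReal.add_ne_top.mpr ⟨hm, hK⟩)).mp ?_
  calc (m + K) * m₀ = m₀ * m + m₀ * K := by ring
    _ ≤ m₀ * m + m * K := by gcongr
    _ = (m₀ + K) * m := by ring
    _ ≤ (m₀ + K) * ((m + K) * t) := by gcongr
    _ = _ := by ring

/-- A lower bound for the probability that two independent Poisson processes have points
`x ∈ A`, `y ∈ B` at distance less than `R`. -/
lemma le_mul_measure_exists_close_pair {Ω E : Type*} [MeasurableSpace Ω] {P : Measure Ω}
    [PseudoMetricSpace E] [ProperSpace E] [MeasurableSpace E] [BorelSpace E]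
    {m₁ m₂ : Measure E} [IsFiniteMeasureOnCompacts m₁] [IsFiniteMeasureOnCompacts m₂]
    {χ₁ χ₂ : Ω → Set E} (h₁ : IsPoissonPointProcess P m₁ χ₁) (h₂ : IsPoissonPointProcess P m₂ χ₂)
    (hind : Indep (sigmaAlgebra χ₁) (sigmaAlgebra χ₂) P)
    {A B : Set E} (hA : MeasurableSet A) (hB : MeasurableSet B) {o : E} {D : ℝ}
    (hAD : A ⊆ Metric.closedBall o D) (hBD : B ⊆ Metric.closedBall o D)
    {R δ : ℝ} (hδ : 0 < δ) {L M M' : ℝ≥0∞} (hMt : M ≠ ⊤) (hMt' : M' ≠ ⊤)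
    (hL : ∀ x ∈ A, L ≤ m₂ (B ∩ Metric.ball x (R - 2 * δ)))
    (hM : ∀ x ∈ A, m₂ (B ∩ Metric.ball x R) ≤ M)
    (hM' : ∀ y ∈ B, m₁ (A ∩ Metric.ball y R) ≤ M') :
    m₁ A * L ≤ (m₁ A * L + (M + M' + 1)) *
      P {ω | ∃ x ∈ χ₁ ω, ∃ y ∈ χ₂ ω, x ∈ A ∧ y ∈ B ∧ dist x y < R} := by
  classical
  obtain ⟨n, C, hCm, hCd, hCδ, hCK⟩ := exists_finite_cells (isCompact_closedBall o D) hδ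
  have hfin : ∀ m : Measure E, ∀ [IsFiniteMeasureOnCompacts m], ∀ S ⊆ Metric.closedBall o D,
      m S ≠ ⊤ := fun m _ S hS =>
    ((measure_mono hS).trans_lt (isCompact_closedBall o D).measure_lt_top).ne
  have hpart : ∀ m : Measure E, ∀ S ⊆ Metric.closedBall o D, MeasurableSet S →
      m S = ∑ j, m (C j ∩ S) := by
    intro m S hS hSm
    have hSeq : S = ⋃ j, C j ∩ S := by
      rw [← Set.iUnion_inter, Set.inter_eq_right.mpr (hS.trans hCK)]
    conv_lhs => rw [hSeq]
    rw [measure_iUnion (fun i j hij => (hCd hij).mono Set.inter_subset_left Set.inter_subset_left)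
      (fun i => (hCm i).inter hSm), tsum_fintype]
  -- The margin `2δ` absorbs two cell diameters: adjacent cells have all their pairs at distance
  -- less than `R`, while every pair closer than `R - 2δ` lies in adjacent cells.
  let adj : Fin n → Fin n → Prop := fun j k => ∃ x ∈ C j, ∃ y ∈ C k, dist x y < R - 2 * δ
  let a : Fin n → Fin n → ℝ≥0∞ := fun j k => if adj j k then 1 else 0
  have hadj : ∀ j k, adj j k → ∀ x ∈ C j, ∀ y ∈ C k, dist x y < R := by
    rintro j k ⟨x', hx', y', hy', hd⟩ x hx y hy
    linarith [dist_triangle4 x x' y' y, hCδ j x hx x' hx', hCδ k y' hy' y hy]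
  have hsum : ∀ (m : Measure E) (S T : Set E) (J : Fin n → Prop) [DecidablePred J],
      MeasurableSet S →
      (∀ k, J k → C k ∩ S ⊆ T) → ∑ k, (if J k then 1 else 0) * m (C k ∩ S) ≤ m (S ∩ T) := by
    intro m S T J _ hS hJ
    have h1 : ∑ k, (if J k then 1 else 0) * m (C k ∩ S) = ∑ k with J k, m (C k ∩ S) := by
      rw [Finset.sum_filter]
      exact Finset.sum_congr rfl fun k _ => by split_ifs <;> simp
    rw [h1, ← measure_biUnion_finset
      (fun i _ j _ hij => (hCd hij).mono Set.inter_subset_left Set.inter_subset_left)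
      (fun i _ => (hCm i).inter hS)]
    refine measure_mono (Set.iUnion₂_subset fun k hk => ?_)
    exact Set.subset_inter Set.inter_subset_right (hJ k (Finset.mem_filter.mp hk).2)
  have hdisj : ∀ S : Set E, Pairwise (fun i j => Disjoint (C i ∩ S) (C j ∩ S)) := fun S i j hij =>
    (hCd hij).mono Set.inter_subset_left Set.inter_subset_left
  have hpA : ∀ j, m₁ (C j ∩ A) ≠ ⊤ := fun j => hfin m₁ _ (Set.inter_subset_right.trans hAD)
  have hpB : ∀ j, m₂ (C j ∩ B) ≠ ⊤ := fun j => hfin m₂ _ (Set.inter_subset_right.trans hBD)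
  have key := le_mul_measure_exists_edge P h₁.sigmaAlgebra_le h₂.sigmaAlgebra_le hind
    (X := fun j => ecount χ₁ (C j ∩ A)) (Y := fun k => ecount χ₂ (C k ∩ B))
    (fun j => measurable_ecount_sigmaAlgebra χ₁ ((hCm j).inter hA))
    (fun k => measurable_ecount_sigmaAlgebra χ₂ ((hCm k).inter hB)) hpA hpB
    (fun j => h₁.lintegral_ecount ((hCm j).inter hA) (hpA j))
    (fun k => h₂.lintegral_ecount ((hCm k).inter hB) (hpB k))
    (fun j j' => h₁.lintegral_ecount_mul (fun i => (hCm i).inter hA) (hdisj A) hpA j j')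
    (fun k k' => h₂.lintegral_ecount_mul (fun i => (hCm i).inter hB) (hdisj B) hpB k k')
    a (fun j k => by simp only [a]; split_ifs <;> simp) M M'
    (by
      intro j hj
      obtain ⟨x, hxC, hxA⟩ := nonempty_of_measure_ne_zero hj
      refine (hsum m₂ B (Metric.ball x R) (adj j) hB ?_).trans (hM x hxA)
      rintro k hk y ⟨hyC, -⟩
      rw [Metric.mem_ball, dist_comm]
      exact hadj j k hk x hxC y hyC)
    (by
      intro k hk
      obtain ⟨y, hyC, hyB⟩ := nonempty_of_measure_ne_zero hk
      refine (hsum m₁ A (Metric.ball y R) (fun j => adj j k) hA ?_).trans (hM' y hyB)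
      rintro j hj x ⟨hxC, -⟩
      exact hadj j k hj x hxC y hyC)
  have hlow : m₁ A * L ≤ ∑ j, ∑ k, a j k * (m₁ (C j ∩ A) * m₂ (C k ∩ B)) := by
    rw [hpart m₁ A hAD hA, Finset.sum_mul]
    refine Finset.sum_le_sum fun j _ => ?_
    rcases eq_or_ne (m₁ (C j ∩ A)) 0 with h0 | h0
    · simp [h0]
    obtain ⟨x, hxC, hxA⟩ := nonempty_of_measure_ne_zero h0
    calc m₁ (C j ∩ A) * L ≤ m₁ (C j ∩ A) * m₂ (B ∩ Metric.ball x (R - 2 * δ)) := by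
          gcongr; exact hL x hxA
      _ = ∑ k, m₁ (C j ∩ A) * m₂ (C k ∩ (B ∩ Metric.ball x (R - 2 * δ))) := by
          rw [hpart m₂ _ (Set.inter_subset_left.trans hBD) (hB.inter measurableSet_ball),
            Finset.mul_sum]
      _ ≤ _ := by
          refine Finset.sum_le_sum fun k _ => ?_
          rw [mul_left_comm]
          gcongr
          rcases Set.eq_empty_or_nonempty (C k ∩ (B ∩ Metric.ball x (R - 2 * δ))) with he | hne
          · simp [he]
          · obtain ⟨y, hyC, -, hy⟩ := hne
            have hjk : adj j k := ⟨x, hxC, y, hyC, by rwa [Metric.mem_ball, dist_comm] at hy⟩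
            simp only [a, if_pos hjk, one_mul]
            exact measure_mono (Set.inter_subset_inter_right _ Set.inter_subset_left)
  have htop : ∑ j, ∑ k, a j k * (m₁ (C j ∩ A) * m₂ (C k ∩ B)) ≠ ⊤ := by
    simp only [ne_eq, ENNReal.sum_eq_top, not_exists, not_and]
    intro j _ k _
    refine ENNReal.mul_ne_top ?_ (ENNReal.mul_ne_top (hpA j) (hpB k))
    simp only [a]; split_ifs <;> simp
  refine le_add_mul_of_le htop (by simp [hMt, hMt']) (by simp) hlow (key.trans ?_)
  refine mul_le_mul' le_rfl (measure_mono ?_)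
  rintro ω ⟨j, k, hjk, hX, hY⟩
  obtain ⟨x, hx, hxC, hxA⟩ := (ecount_ne_zero_iff _ _ _).mp hX
  obtain ⟨y, hy, hyC, hyB⟩ := (ecount_ne_zero_iff _ _ _).mp hY
  refine ⟨x, hx, y, hy, hxA, hyB, hadj j k ?_ x hxC y hyC⟩
  by_contra hc
  exact hjk (by simp [a, hc])

/-! ### The event as an open condition on pairs of centres. -/

lemma eventGPlus_eq {Ω : Type*} {d : ℕ} (hd : 3 ≤ d) {ρ : ℝ} (hρ : 0 < ρ)
    (χ₁ χρ : Ω → Set (EuclideanSpace ℝ (Fin d))) (x₀ : EuclideanSpace ℝ (Fin d)) :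
    eventGPlus hd ρ χ₁ χρ x₀ = {ω | ∃ x ∈ χ₁ ω, ∃ y ∈ χρ ω,
      (x, y) ∈ {z : EuclideanSpace ℝ (Fin d) × EuclideanSpace ℝ (Fin d) |
        (z.1 ∈ slabWPlus d hd ∧ z.2 ∈ slabWPlus d hd) ∧ dist x₀ z.1 < 1 + ρ ∧
          dist z.1 z.2 < 1 + ρ}} := by
  have hball : ∀ (x y : EuclideanSpace ℝ (Fin d)) (r s : ℝ), 0 < r → 0 < s →
      ((Metric.ball x r ∩ Metric.ball y s).Nonempty ↔ dist x y < r + s) := by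
    intro x y r s hr hs
    rw [← Set.not_disjoint_iff_nonempty_inter, disjoint_ball_ball_iff hr hs, not_le]
  ext ω
  constructor
  · rintro ⟨x, ⟨hx, hxW⟩, y, ⟨hy, hyW⟩, h1, h2⟩
    rw [hball _ _ _ _ hρ one_pos, add_comm] at h1
    rw [hball _ _ _ _ one_pos hρ] at h2
    exact ⟨x, hx, y, hy, ⟨hxW, hyW⟩, h1, h2⟩
  · rintro ⟨x, hx, y, hy, ⟨hxW, hyW⟩, h1, h2⟩
    refine ⟨x, ⟨hx, hxW⟩, y, ⟨hy, hyW⟩, ?_, ?_⟩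
    · rw [hball _ _ _ _ hρ one_pos, add_comm]; exact h1
    · rw [hball _ _ _ _ one_pos hρ]; exact h2

lemma isOpen_slabWPlus {d : ℕ} (hd : 3 ≤ d) : IsOpen (slabWPlus d hd) := by
  have h : ∀ i : Fin d, Continuous fun x : EuclideanSpace ℝ (Fin d) => x i := fun i => by fun_prop
  exact (isOpen_Ioo.preimage (h _)).inter (isOpen_Ioo.preimage (h _))

lemma measurableSet_eventGPlus {Ω : Type*} [MeasurableSpace Ω] {d : ℕ} (hd : 3 ≤ d) {ρ : ℝ}
    (hρ : 0 < ρ) {χ₁ χρ : Ω → Set (EuclideanSpace ℝ (Fin d))}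
    (h : ∀ A, MeasurableSet A → Measurable (count χ₁ A))
    (h' : ∀ A, MeasurableSet A → Measurable (count χρ A)) (x₀ : EuclideanSpace ℝ (Fin d)) :
    MeasurableSet (eventGPlus hd ρ χ₁ χρ x₀) := by
  rw [eventGPlus_eq hd hρ]
  refine measurableSet_exists_pair_mem h h' ?_
  have hW := isOpen_slabWPlus hd
  have h1 : IsOpen {z : EuclideanSpace ℝ (Fin d) × EuclideanSpace ℝ (Fin d) |
      dist x₀ z.1 < 1 + ρ} := isOpen_lt (by fun_prop) continuous_const
  have h2 : IsOpen {z : EuclideanSpace ℝ (Fin d) × EuclideanSpace ℝ (Fin d) |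
      dist z.1 z.2 < 1 + ρ} := isOpen_lt (by fun_prop) continuous_const
  exact ((hW.preimage continuous_fst).inter (hW.preimage continuous_snd)).inter (h1.inter h2)

/-! ### Choice of `s`, and the mean number of points in a ball. -/

lemma eventually_poly_mul_pow_le {a b C : ℝ} (ha : 0 ≤ a) (hab : a < b) (k : ℕ) :
    ∀ᶠ d : ℕ in atTop, C * (20 * d + 1) ^ k * a ^ d ≤ b ^ d := by
  have hb : 0 < b := ha.trans_lt hab
  have hq : |a / b| < 1 := by
    rw [abs_of_nonneg (by positivity), div_lt_one hb]; exact hab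
  have ht := (tendsto_pow_const_mul_const_pow_of_abs_lt_one k hq).const_mul (|C| * 21 ^ k)
  rw [mul_zero] at ht
  filter_upwards [ht.eventually (ge_mem_nhds one_pos), eventually_ge_atTop 1] with d hd hd1
  have hd1' : (1 : ℝ) ≤ d := by exact_mod_cast hd1
  have hbd : 0 < b ^ d := by positivity
  rw [div_pow] at hd
  calc C * (20 * d + 1) ^ k * a ^ d ≤ |C| * (21 * d) ^ k * a ^ d := by
        gcongr
        · exact le_abs_self C
        · linarith
    _ = (|C| * 21 ^ k * (d ^ k * (a ^ d / b ^ d))) * b ^ d := by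
        rw [mul_pow]; field_simp
    _ ≤ 1 * b ^ d := by gcongr
    _ = b ^ d := one_mul _

/-- Both inequalities are strict at `s = 1`, the second because `ρ < 2`, so they persist for `s`
slightly smaller. -/
lemma exists_contraction {ρ α : ℝ} (hρ1 : 1 < ρ) (hρ2 : ρ < 2) (hα : ρ < α ^ 2) :
    ∃ s : ℝ, 0 < s ∧ s < 1 ∧ ρ < α ^ 2 * s ^ 4 ∧ 2 - 2 / ρ < s ^ 6 := by
  have h1 : ∀ᶠ s : ℝ in 𝓝[<] 1, ρ < α ^ 2 * s ^ 4 := by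
    have : ContinuousAt (fun s : ℝ => α ^ 2 * s ^ 4) 1 := by fun_prop
    exact (this.eventually (lt_mem_nhds (by simpa using hα))).filter_mono nhdsWithin_le_nhds
  have h2 : ∀ᶠ s : ℝ in 𝓝[<] 1, 2 - 2 / ρ < s ^ 6 := by
    have : ContinuousAt (fun s : ℝ => s ^ 6) 1 := by fun_prop
    refine (this.eventually (lt_mem_nhds ?_)).filter_mono nhdsWithin_le_nhds
    have : 1 < 2 / ρ := by rw [lt_div_iff₀] <;> linarith
    norm_num; linarith
  have h3 : ∀ᶠ s : ℝ in 𝓝[<] 1, 0 < s :=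
    (lt_mem_nhds one_pos).filter_mono nhdsWithin_le_nhds
  obtain ⟨s, ⟨h1, h2⟩, h3, h4⟩ := ((h1.and h2).and (h3.and self_mem_nhdsWithin)).exists
  exact ⟨s, h3, h4, h1, h2⟩

lemma unitBallVolume_pos (d : ℕ) : 0 < unitBallVolume d :=
  ENNReal.toReal_pos (Metric.measure_ball_pos _ _ one_pos).ne' measure_ball_lt_top.ne

lemma intensity_measure_ball {κ t r : ℝ} (hκ : 0 < κ) (ht : 0 < t) (hr : 0 < r) {d : ℕ}
    (x : EuclideanSpace ℝ (Fin d)) :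
    (ENNReal.ofReal (intensity κ d t) • (volume : Measure (EuclideanSpace ℝ (Fin d))))
      (Metric.ball x r) = ENNReal.ofReal ((κ * r / (2 * t)) ^ d) := by
  have hv := unitBallVolume_pos d
  have hv' : volume (Metric.ball (0 : EuclideanSpace ℝ (Fin d)) 1) =
      ENNReal.ofReal (unitBallVolume d) := (ENNReal.ofReal_toReal measure_ball_lt_top.ne).symm
  have hi : 0 ≤ intensity κ d t := by unfold intensity; positivity
  rw [Measure.smul_apply, smul_eq_mul, volume_ball_eq x hr, hv', ← ENNReal.ofReal_mul (by positivity),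
    ← ENNReal.ofReal_mul hi]
  congr 1
  rw [intensity, div_pow, mul_pow, mul_pow]
  field_simp

/-! ### The two regions and their volumes. -/

/-- Points of `W⁺` at distance roughly `R` from `x₀`. -/
def innerRegion {d : ℕ} (hd : 3 ≤ d) (x₀ : EuclideanSpace ℝ (Fin d)) (s R : ℝ) :
    Set (EuclideanSpace ℝ (Fin d)) :=
  {x | x ∈ slabWPlus d hd ∧ s ^ 2 * R ≤ ‖x - x₀‖ ∧ ‖x - x₀‖ < R}

/-- Points of `W⁺` at distance at least roughly `√2 R`, and at most `2 R`, from `x₀`. -/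
def outerRegion {d : ℕ} (hd : 3 ≤ d) (x₀ : EuclideanSpace ℝ (Fin d)) (s R : ℝ) :
    Set (EuclideanSpace ℝ (Fin d)) :=
  {y | y ∈ slabWPlus d hd ∧ 2 * s ^ 6 * R ^ 2 ≤ ‖y - x₀‖ ^ 2 ∧ ‖y - x₀‖ < 2 * R}

section

variable {d : ℕ} (hd : 3 ≤ d) (x₀ : EuclideanSpace ℝ (Fin d)) {s R : ℝ}

lemma measurableSet_innerRegion (s R : ℝ) : MeasurableSet (innerRegion hd x₀ s R) := by
  have h : Measurable fun x => ‖x - x₀‖ := by fun_prop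
  exact (isOpen_slabWPlus hd).measurableSet.inter
    ((measurableSet_le measurable_const h).inter (measurableSet_lt h measurable_const))

lemma measurableSet_outerRegion (s R : ℝ) : MeasurableSet (outerRegion hd x₀ s R) := by
  have h : Measurable fun x => ‖x - x₀‖ := by fun_prop
  exact (isOpen_slabWPlus hd).measurableSet.inter
    ((measurableSet_le measurable_const (h.pow_const 2)).inter
      (measurableSet_lt h measurable_const))

variable {x₀}

lemma volume_ball_le_innerRegion (hx₀ : x₀ ∈ slabW d hd) (hs0 : 0 < s) (hs1 : s < 1) (hR0 : 0 < R)
    (hR : R < 3) (hsd : 4 * (20 * d + 1) ^ 2 * s ^ d ≤ 1)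
    (hd1 : (s * R) ^ 2 + 8 / d ≤ (R * (1 + s) / 2) ^ 2) :
    volume (Metric.ball x₀ (s * R)) ≤ ((4 * (20 * d + 1) ^ 2 : ℕ) : ℝ≥0∞) *
      volume (innerRegion hd x₀ s R) := by
  obtain ⟨⟨a1, a2⟩, b1, b2⟩ := hx₀
  refine (volume_ball_le_slab hd x₀ 0 (abs_le.mpr ⟨a1.le, a2.le⟩)
    (abs_le.mpr ⟨b1.le, b2.le.trans (by positivity)⟩) rfl rfl (mul_pos hs0 hR0) (by nlinarith)
    hs0 hsd).trans ?_
  gcongr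
  rintro z ⟨hz, -, hz1, hz2⟩
  refine ⟨hz, by linarith, lt_of_pow_lt_pow_left₀ 2 hR0.le ?_⟩
  have : R * (1 + s) / 2 ≤ R := by nlinarith
  calc _ < _ := hz1
    _ ≤ _ := hd1
    _ ≤ _ := by gcongr

lemma volume_ball_le_outerRegion (hx₀ : x₀ ∈ slabW d hd) (hs0 : 0 < s) (hs1 : s < 1) (hR0 : 0 < R)
    (hR : R < 3) (hsd : 4 * (20 * d + 1) ^ 2 * s ^ d ≤ 1)
    (hd1 : (s * R) ^ 2 + 8 / d ≤ (R * (1 + s) / 2) ^ 2)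
    (hd2 : 2 * s ^ 6 * R ^ 2 + 8 / d ≤ 2 * s ^ 4 * R ^ 2) {x : EuclideanSpace ℝ (Fin d)}
    (hx : x ∈ innerRegion hd x₀ s R) :
    volume (Metric.ball x (s * R)) ≤ ((4 * (20 * d + 1) ^ 2 : ℕ) : ℝ≥0∞) *
      volume (outerRegion hd x₀ s R ∩ Metric.ball x (R * (1 + s) / 2)) := by
  obtain ⟨hxW, hx1, hx2⟩ := hx
  set i0 : Fin d := ⟨0, by omega⟩ with hi0
  set i1 : Fin d := ⟨1, by omega⟩ with hi1
  have h01 : i0 ≠ i1 := by simp [hi0, hi1]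
  set h : ℝ := 1 / √(d : ℝ) with hh
  have hh2 : h ^ 2 = 1 / d := inv_sqrt_sq d
  obtain ⟨⟨a1, a2⟩, b1, b2⟩ := hxW
  change 0 < x i0 at a1
  change x i0 < h at a2
  change 0 < x i1 at b1
  change x i1 < h at b2
  obtain ⟨⟨p1, p2⟩, q1, q2⟩ := hx₀
  change -h < x₀ i0 at p1
  change x₀ i0 < h at p2
  change -h < x₀ i1 at q1
  change x₀ i1 < 0 at q2
  -- Removing the first two coordinates of `x - x₀` leaves a direction that the slab translations do
  -- not see.
  let u : EuclideanSpace ℝ (Fin d) := (x i0 - x₀ i0) • EuclideanSpace.single i0 (1 : ℝ) +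
      (x i1 - x₀ i1) • EuclideanSpace.single i1 (1 : ℝ)
  have hw0 : (x - x₀ - u) i0 = 0 := by simp [u, h01]
  have hw1 : (x - x₀ - u) i1 = 0 := by simp [u, h01.symm]
  refine (volume_ball_le_slab hd x (x - x₀ - u)
    (abs_le.mpr ⟨by linarith, a2.le⟩)
    (abs_le.mpr ⟨by linarith, b2.le⟩) hw0 hw1 (mul_pos hs0 hR0) (by nlinarith)
    hs0 hsd).trans ?_
  gcongr
  rintro y ⟨hy, hyw, hy1, hy2⟩
  have hr : R * (1 + s) / 2 ≤ R := by nlinarith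
  have hyx : ‖y - x‖ < R * (1 + s) / 2 :=
    lt_of_pow_lt_pow_left₀ 2 (by positivity) (hy1.trans_le hd1)
  have hyeq : y - x₀ = (y - x) + (x - x₀) := by abel
  refine ⟨⟨hy, ?_, ?_⟩, ?_⟩
  · obtain ⟨⟨c1, c2⟩, e1, e2⟩ := hy
    change 0 < y i0 at c1
    change y i0 < h at c2
    change 0 < y i1 at e1
    change y i1 < h at e2
    have hin : ⟪y - x, x - x₀⟫ = ⟪y - x, x - x₀ - u⟫ +
        ((x i0 - x₀ i0) * (y i0 - x i0) + (x i1 - x₀ i1) * (y i1 - x i1)) := by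
      rw [inner_sub_right _ (x - x₀) u]
      simp [u, inner_add_right, inner_smul_right, EuclideanSpace.inner_single_right]
    rw [hyeq, norm_add_sq_real, hin]
    have h8 : (8 : ℝ) / d = 8 * h ^ 2 := by rw [hh2]; ring
    -- Each of the two slab coordinates contributes at least `-2h²` to the inner product, hence a
    -- total loss of `8h² = 8/d` in `‖y - x₀‖²`.
    have hprod : ∀ a b : ℝ, |a| ≤ 2 * h → |b| ≤ h → -(2 * h ^ 2) ≤ a * b := by
      intro a b ha hb
      have : |a * b| ≤ 2 * h * h := by
        rw [abs_mul]; exact mul_le_mul ha hb (abs_nonneg b) ((abs_nonneg a).trans ha)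
      linarith [neg_abs_le (a * b)]
    have hA := hprod (x i0 - x₀ i0) (y i0 - x i0) (abs_le.mpr ⟨by linarith, by linarith⟩)
      (abs_le.mpr ⟨by linarith, by linarith⟩)
    have hB := hprod (x i1 - x₀ i1) (y i1 - x i1) (abs_le.mpr ⟨by linarith, by linarith⟩)
      (abs_le.mpr ⟨by linarith, by linarith⟩)
    have hC : (s ^ 2 * R) ^ 2 ≤ ‖x - x₀‖ ^ 2 := by gcongr
    have hD : (s ^ 2 * R) ^ 2 ≤ ‖y - x‖ ^ 2 := by
      gcongr
      linarith
    have hE : (s ^ 2 * R) ^ 2 = s ^ 4 * R ^ 2 := by ring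
    rw [h8] at hd2
    rw [hE] at hC hD
    linarith
  · rw [hyeq]
    linarith [norm_add_le (y - x) (x - x₀)]
  · rwa [Metric.mem_ball, dist_eq_norm]

lemma innerRegion_inter_ball_subset {y : EuclideanSpace ℝ (Fin d)}
    (hy : y ∈ outerRegion hd x₀ s R) {l : ℝ} (hl : 0 < l) (hl2 : R ^ 2 * (1 - s ^ 6 / 2) ≤ l ^ 2) :
    innerRegion hd x₀ s R ∩ Metric.ball y R ⊆ Metric.ball ((1 / 2 : ℝ) • (x₀ + y)) l := by
  refine Set.Subset.trans (Set.inter_subset_inter_left _ ?_)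
    (ball_inter_ball_subset x₀ y (R := R) hl ?_)
  · intro x hx
    rw [Metric.mem_ball, dist_eq_norm]
    exact hx.2.2
  · rw [norm_sub_rev]
    nlinarith [hy.2.1]

end

/-! ### Assembly, and domination of the error terms for large `d`. -/

lemma smul_measure_le_mul {E : Type*} [MeasurableSpace E] {μ : Measure E} {k c : ℝ≥0∞}
    {S T : Set E} (h : μ S ≤ c * μ T) : (k • μ) S ≤ c * (k • μ) T := by
  simp only [Measure.smul_apply, smul_eq_mul]
  rw [mul_left_comm]
  gcongr

lemma le_measureReal_eventGPlus {ρ κ p s : ℝ} (hρ1 : 1 < ρ) (hρ2 : ρ < 2) (hκ : 0 < κ)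
    (hs0 : 0 < s) (hs1 : s < 1) {d : ℕ} (hd : 3 ≤ d)
    (hsd : 4 * (20 * d + 1) ^ 2 * s ^ d ≤ 1)
    (hd1 : (s * (1 + ρ)) ^ 2 + 8 / d ≤ ((1 + ρ) * (1 + s) / 2) ^ 2)
    (hd2 : 2 * s ^ 6 * (1 + ρ) ^ 2 + 8 / d ≤ 2 * s ^ 4 * (1 + ρ) ^ 2)
    (hlarge : p * ((κ * (1 + ρ) / (2 * ρ)) ^ d +
      (κ * ((1 + ρ) * √(1 - s ^ 6 / 2)) / (2 * 1)) ^ d + 1) * (4 * (20 * d + 1) ^ 2) ^ 2 ≤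
      (1 - p) * ((κ * (s * (1 + ρ)) / (2 * 1)) ^ d * (κ * (s * (1 + ρ)) / (2 * ρ)) ^ d))
    {Ω : Type*} [MeasurableSpace Ω] {P : Measure Ω} [IsProbabilityMeasure P]
    {χ₁ χρ : Ω → Set (EuclideanSpace ℝ (Fin d))}
    (h₁ : IsStationaryPoisson P (intensity κ d 1) χ₁)
    (hρ : IsStationaryPoisson P (intensity κ d ρ) χρ)
    (hind : Indep (sigmaAlgebra χ₁) (sigmaAlgebra χρ) P)
    {x₀ : EuclideanSpace ℝ (Fin d)} (hx₀ : x₀ ∈ slabW d hd) :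
    p ≤ P.real (eventGPlus hd ρ χ₁ χρ x₀) := by
  set R := 1 + ρ with hR
  have hR0 : 0 < R := by linarith
  have hR3 : R < 3 := by linarith
  have hρ0 : 0 < ρ := by linarith
  set l := R * √(1 - s ^ 6 / 2) with hl
  have hs6 : s ^ 6 ≤ 1 := pow_le_one₀ hs0.le hs1.le
  have hl0 : 0 < l := mul_pos hR0 (Real.sqrt_pos.mpr (by linarith))
  have hl2 : R ^ 2 * (1 - s ^ 6 / 2) ≤ l ^ 2 := by
    rw [hl, mul_pow, Real.sq_sqrt (by linarith)]
  set m₁ : Measure (EuclideanSpace ℝ (Fin d)) := ENNReal.ofReal (intensity κ d 1) • volume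
    with hm₁
  set m₂ : Measure (EuclideanSpace ℝ (Fin d)) := ENNReal.ofReal (intensity κ d ρ) • volume
    with hm₂
  have : IsFiniteMeasureOnCompacts m₁ := IsFiniteMeasureOnCompacts.smul _ ENNReal.ofReal_ne_top
  have : IsFiniteMeasureOnCompacts m₂ := IsFiniteMeasureOnCompacts.smul _ ENNReal.ofReal_ne_top
  set A := innerRegion hd x₀ s R with hA
  set B := outerRegion hd x₀ s R with hB
  set c : ℕ := 4 * (20 * d + 1) ^ 2 with hc
  have hc0 : (c : ℝ≥0∞) ≠ 0 := by simp [hc]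
  have hcr : (c : ℝ) = 4 * (20 * d + 1) ^ 2 := by rw [hc]; push_cast; ring
  have hcpos : (0 : ℝ) < c := by rw [hcr]; positivity
  set x := (κ * (s * R) / (2 * 1)) ^ d with hx
  set y := (κ * (s * R) / (2 * ρ)) ^ d with hy
  have hx0 : 0 < x := by positivity
  have hy0 : 0 < y := by positivity
  have hmA : ENNReal.ofReal (x / c) ≤ m₁ A := by
    rw [ENNReal.ofReal_div_of_pos hcpos, ENNReal.ofReal_natCast]
    refine ENNReal.div_le_of_le_mul' ?_
    rw [hx, ← intensity_measure_ball hκ one_pos (mul_pos hs0 hR0) x₀]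
    exact smul_measure_le_mul (volume_ball_le_innerRegion hd hx₀ hs0 hs1 hR0 hR3 hsd hd1)
  -- `δ` is chosen so that `R - 2δ = R(1 + s)/2`, the radius in `volume_ball_le_outerRegion`.
  have key := le_mul_measure_exists_close_pair h₁ hρ hind (measurableSet_innerRegion hd x₀ s R)
    (measurableSet_outerRegion hd x₀ s R) (o := x₀) (D := 2 * R) (R := R)
    (δ := R * (1 - s) / 4) (L := ENNReal.ofReal (y / c))
    (M := ENNReal.ofReal ((κ * R / (2 * ρ)) ^ d)) (M' := ENNReal.ofReal ((κ * l / (2 * 1)) ^ d))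
    (by
      intro z hz
      rw [Metric.mem_closedBall, dist_eq_norm]
      linarith [hz.2.2])
    (by
      intro z hz
      rw [Metric.mem_closedBall, dist_eq_norm]
      exact hz.2.2.le)
    (by
      have : 0 < 1 - s := by linarith
      positivity)
    ENNReal.ofReal_ne_top ENNReal.ofReal_ne_top
    (by
      intro z hz
      rw [show R - 2 * (R * (1 - s) / 4) = R * (1 + s) / 2 by ring,
        ENNReal.ofReal_div_of_pos hcpos, ENNReal.ofReal_natCast]
      refine ENNReal.div_le_of_le_mul' ?_
      rw [hy, ← intensity_measure_ball hκ hρ0 (mul_pos hs0 hR0) z]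
      exact smul_measure_le_mul
        (volume_ball_le_outerRegion hd hx₀ hs0 hs1 hR0 hR3 hsd hd1 hd2 hz))
    (by
      intro z hz
      rw [← intensity_measure_ball hκ hρ0 hR0 z]
      exact measure_mono Set.inter_subset_right)
    (by
      intro z hz
      rw [← intensity_measure_ball hκ one_pos hl0 ((1 / 2 : ℝ) • (x₀ + z))]
      exact measure_mono (innerRegion_inter_ball_subset hd hz hl0 hl2))
  set G := {ω | ∃ x ∈ χ₁ ω, ∃ y ∈ χρ ω, x ∈ innerRegion hd x₀ s R ∧
    y ∈ outerRegion hd x₀ s R ∧ dist x y < R} with hG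
  have hGsub : G ⊆ eventGPlus hd ρ χ₁ χρ x₀ := by
    rw [eventGPlus_eq hd hρ0]
    rintro ω ⟨u, hu, v, hv, huA, hvB, huv⟩
    refine ⟨u, hu, v, hv, ⟨huA.1, hvB.1⟩, ?_, huv⟩
    change dist x₀ u < R
    rw [dist_comm, dist_eq_norm]
    exact huA.2.2
  have hAtop : m₁ A ≠ ⊤ := by
    refine ((measure_mono ?_).trans_lt (isCompact_closedBall x₀ R).measure_lt_top).ne
    intro z hz
    rw [Metric.mem_closedBall, dist_eq_norm]
    exact hz.2.2.le
  have hlow := le_add_mul_of_le (m₀ := ENNReal.ofReal (x / c * (y / c)))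
    (ENNReal.mul_ne_top hAtop ENNReal.ofReal_ne_top) (by finiteness) (by simp)
    (by rw [ENNReal.ofReal_mul (by positivity)]; gcongr) key
  rw [← ENNReal.ofReal_one, ← ENNReal.ofReal_add (by positivity) (by positivity),
    ← ENNReal.ofReal_add (by positivity) (by positivity),
    ← ENNReal.ofReal_add (by positivity) (by positivity), ← ofReal_measureReal,
    ← ENNReal.ofReal_mul (by positivity), ENNReal.ofReal_le_ofReal_iff (by positivity)] at hlow
  have hmono : P.real G ≤ P.real (eventGPlus hd ρ χ₁ χρ x₀) := measureReal_mono hGsub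
  refine le_trans ?_ hmono
  set K := (κ * R / (2 * ρ)) ^ d + (κ * l / (2 * 1)) ^ d + 1 with hK
  have hK0 : 0 < K := by positivity
  have hxy : 0 < x / c * (y / c) := by positivity
  -- Equivalent to `p ≤ m₀ / (m₀ + K)` for the lower bound `m₀ = (x/c)(y/c)` of the mean.
  have hpK : p * K ≤ (1 - p) * (x / c * (y / c)) := by
    rw [show (1 - p) * (x / c * (y / c)) = (1 - p) * (x * y) / (c : ℝ) ^ 2 by field_simp,
      le_div_iff₀ (by positivity), hcr]
    exact hlarge
  refine le_of_mul_le_mul_left ?_ (add_pos hxy hK0)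
  linarith

lemma eventually_parameters {ρ κ p s : ℝ} (hρ1 : 1 < ρ) (hρ2 : ρ < 2) (hκ : 0 < κ)
    (hp0 : 0 < p) (hp1 : p < 1) (hs0 : 0 < s) (hs1 : s < 1)
    (hs4 : ρ < (κ * (1 + ρ) / 2) ^ 2 * s ^ 4) (hs6 : 2 - 2 / ρ < s ^ 6) :
    ∀ᶠ d : ℕ in atTop, 4 * (20 * d + 1) ^ 2 * s ^ d ≤ 1 ∧
      (s * (1 + ρ)) ^ 2 + 8 / d ≤ ((1 + ρ) * (1 + s) / 2) ^ 2 ∧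
      2 * s ^ 6 * (1 + ρ) ^ 2 + 8 / d ≤ 2 * s ^ 4 * (1 + ρ) ^ 2 ∧
      p * ((κ * (1 + ρ) / (2 * ρ)) ^ d +
      (κ * ((1 + ρ) * √(1 - s ^ 6 / 2)) / (2 * 1)) ^ d + 1) * (4 * (20 * d + 1) ^ 2) ^ 2 ≤
      (1 - p) * ((κ * (s * (1 + ρ)) / (2 * 1)) ^ d * (κ * (s * (1 + ρ)) / (2 * ρ)) ^ d) := by
  have hρ0 : 0 < ρ := by linarith
  set α := κ * (1 + ρ) / 2 with hα
  have hα0 : 0 < α := by positivity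
  set l := √(1 - s ^ 6 / 2) with hl
  -- The growth rate of the mean; it must exceed the rates `α / ρ`, `α * l` and `1` of `M`, `M'` and
  -- the constant term.
  set b := α ^ 2 * s ^ 2 / ρ with hb
  have hs2 : s ^ 2 < 1 := by nlinarith
  have hs2' : 0 < s ^ 2 := by positivity
  have hs24 : s ^ 4 < s ^ 2 := by
    calc s ^ 4 = s ^ 2 * s ^ 2 := by ring
      _ < s ^ 2 := by nlinarith
  have hs46 : s ^ 6 < s ^ 4 := by
    calc s ^ 6 = s ^ 4 * s ^ 2 := by ring
      _ < s ^ 4 * 1 := by gcongr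
      _ = s ^ 4 := mul_one _
  have hαs : 1 < α * s ^ 2 := by
    by_contra hcon
    have : (α * s ^ 2) ^ 2 ≤ 1 := pow_le_one₀ (by positivity) (not_lt.mp hcon)
    nlinarith
  have hb1 : 1 < b := by
    rw [hb, lt_div_iff₀ hρ0, one_mul]
    have : α ^ 2 * s ^ 4 < α ^ 2 * s ^ 2 := by gcongr
    linarith
  have hbβ : α / ρ < b := by
    rw [hb, div_lt_div_iff_of_pos_right hρ0]
    nlinarith
  have hl0 : 0 ≤ l := Real.sqrt_nonneg _
  have hlb : α * l < b := by
    -- Both sides are compared with `1/√ρ`: `hs6` gives `l² < 1/ρ`, and `hs4` gives `1/ρ < (α s² /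
    -- ρ)²`.
    have hll : l < α * s ^ 2 / ρ := by
      rw [hl]
      refine (Real.sqrt_lt' (by positivity)).mpr ?_
      have h1 : 1 - s ^ 6 / 2 < 1 / ρ := by
        have : 2 / ρ = 2 * (1 / ρ) := by ring
        linarith
      refine h1.trans ?_
      rw [div_pow, div_lt_div_iff₀ hρ0 (by positivity)]
      nlinarith
    calc α * l < α * (α * s ^ 2 / ρ) := by gcongr
      _ = b := by rw [hb]; ring
  have h8 : Tendsto (fun d : ℕ => (8 : ℝ) / d) atTop (𝓝 0) := tendsto_const_div_atTop_nhds_zero_nat 8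
  have hpow1 := eventually_poly_mul_pow_le (C := 4) hs0.le hs1 2
  have hpos1 : 0 < ((1 + ρ) * (1 + s) / 2) ^ 2 - (s * (1 + ρ)) ^ 2 := by
    have : s * (1 + ρ) < (1 + ρ) * (1 + s) / 2 := by nlinarith
    have : (s * (1 + ρ)) ^ 2 < ((1 + ρ) * (1 + s) / 2) ^ 2 := by gcongr
    linarith
  have hpos2 : 0 < 2 * s ^ 4 * (1 + ρ) ^ 2 - 2 * s ^ 6 * (1 + ρ) ^ 2 := by
    have : 2 * s ^ 6 * (1 + ρ) ^ 2 < 2 * s ^ 4 * (1 + ρ) ^ 2 := by gcongr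
    linarith
  have hp1' : 0 < 1 - p := by linarith
  filter_upwards [hpow1, h8.eventually (ge_mem_nhds hpos1), h8.eventually (ge_mem_nhds hpos2),
    eventually_poly_mul_pow_le (C := 48 * p / (1 - p)) (by positivity) hbβ 4,
    eventually_poly_mul_pow_le (C := 48 * p / (1 - p)) (by positivity) hlb 4,
    eventually_poly_mul_pow_le (C := 48 * p / (1 - p)) zero_le_one hb1 4]
    with d e1 e2 e3 e4 e5 e6
  rw [one_pow] at e1 e6
  refine ⟨e1, by linarith, by linarith, ?_⟩
  have hb' : (κ * (s * (1 + ρ)) / (2 * 1)) ^ d * (κ * (s * (1 + ρ)) / (2 * ρ)) ^ d = b ^ d := by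
    rw [← mul_pow]
    congr 1
    rw [hb, hα]; field_simp
  rw [hb', show κ * (1 + ρ) / (2 * ρ) = α / ρ by rw [hα]; field_simp,
    show κ * ((1 + ρ) * l) / (2 * 1) = α * l by rw [hα]; ring]
  -- `48 = 3 · 16`: three error terms, and `16` from `(4 (20d + 1)²)²`.
  have hsum : 48 * p / (1 - p) * (20 * d + 1) ^ 4 * ((α / ρ) ^ d + (α * l) ^ d + 1) ≤
      3 * b ^ d := by linarith
  have heq : p * ((α / ρ) ^ d + (α * l) ^ d + 1) * (4 * (20 * d + 1) ^ 2) ^ 2 =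
      (1 - p) / 3 *
        (48 * p / (1 - p) * (20 * d + 1) ^ 4 * ((α / ρ) ^ d + (α * l) ^ d + 1)) := by
    field_simp
    ring
  rw [heq]
  calc _ ≤ (1 - p) / 3 * (3 * b ^ d) := by gcongr
    _ = _ := by ring

end TwoTypeBoolean

theorem mainTheorem5 (ρ : ℝ) (hρ1 : 1 < ρ) (hρ2 : ρ < 2)
    (κ : ℝ) (hκ1 : TwoTypeBoolean.kappaCrit ρ < κ) (hκ2 : κ < 1)
    (p : ℝ) (hp0 : 0 < p) (hp1 : p < 1) :
    ∃ d₀ : ℕ, ∀ (d : ℕ) (hd : 3 ≤ d), d₀ ≤ d →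
      ∀ (Ω : Type*) [MeasurableSpace Ω] (P : Measure Ω) [IsProbabilityMeasure P]
        (χ₁ χρ : Ω → Set (EuclideanSpace ℝ (Fin d))),
        TwoTypeBoolean.IsStationaryPoisson P (TwoTypeBoolean.intensity κ d 1) χ₁ →
        TwoTypeBoolean.IsStationaryPoisson P (TwoTypeBoolean.intensity κ d ρ) χρ →
        Indep (TwoTypeBoolean.sigmaAlgebra χ₁) (TwoTypeBoolean.sigmaAlgebra χρ) P →
        ∀ x₀ ∈ TwoTypeBoolean.slabW d hd,
          MeasurableSet (TwoTypeBoolean.eventGPlus hd ρ χ₁ χρ x₀) ∧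
          p ≤ P.real (TwoTypeBoolean.eventGPlus hd ρ χ₁ χρ x₀) := by
  have hρ0 : 0 < ρ := by linarith
  have hκ0 : 0 < κ := lt_of_le_of_lt (by unfold TwoTypeBoolean.kappaCrit; positivity) hκ1
  have hα : ρ < (κ * (1 + ρ) / 2) ^ 2 := by
    have h1 : √ρ < κ * (1 + ρ) / 2 := by
      rw [TwoTypeBoolean.kappaCrit, div_lt_iff₀ (by linarith)] at hκ1
      linarith
    exact (Real.sqrt_lt' (by positivity)).mp h1
  obtain ⟨s, hs0, hs1, hs4, hs6⟩ := TwoTypeBoolean.exists_contraction hρ1 hρ2 hα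
  obtain ⟨d₀, hd₀⟩ := Filter.eventually_atTop.mp
    (TwoTypeBoolean.eventually_parameters hρ1 hρ2 hκ0 hp0 hp1 hs0 hs1 hs4 hs6)
  refine ⟨d₀, fun d hd hdd Ω _ P _ χ₁ χρ h₁ hρ hind x₀ hx₀ => ⟨?_, ?_⟩⟩
  · exact TwoTypeBoolean.measurableSet_eventGPlus hd hρ0 h₁.measurable_count
      hρ.measurable_count x₀
  · obtain ⟨e1, e2, e3, e4⟩ := hd₀ d hdd
    exact TwoTypeBoolean.le_measureReal_eventGPlus hρ1 hρ2 hκ0 hs0 hs1 hd e1 e2 e3 e4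
      h₁ hρ hind hx₀
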